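/- Let $G$ be the Coxeter group of type $H_4$, with generators $s_1,s_2,s_3,s_4$ and relations $s_i^2=1$, $(s_1s_2)^5=(s_2s_3)^3=(s_3s_4)^3=1$, $(s_1s_3)^2=(s_1s_4)^2=(s_2s_4)^2=1$. Let $X=\{s_1,s_2,s_3,s_4\}$, let $\langle X\rangle$ be the free monoid of words on $X$, and order $\langle X\rangle$ by the degree-lexicographic order with $s_4>s_3>s_2>s_1$ (compare lengths first, then lexicographically from the left). The leading monomial $\overline p$ of a nonzero $p\in\mathbb C\langle X\rangle$ is the largest word that occurs in $p$, and $p$ is monic if the coefficient of $\overline p$ in $p$ is $1$. **Definitions.** Let $S\subset\mathbb C\langle X\rangle$ be a set of monic elements. A word is $S$-standard if it has no factor (contiguous subword) $\overline r$ with $r\in S$. For a word $w$, write $p\equiv 0 \bmod (S;w)$ if $p=\sum_i\alpha_iu_ir_iv_i$ is a finite sum with $\alpha_i\in\mathbb C$, $u_i,v_i\in\langle X\rangle$, $r_i\in S$ and $u_i\overline{r_i}v_i<w$ for all $i$. The set $S$ is a Gröbner–Shirshov basis if it is closed under composition, i.e. for all $p,q\in S$ and all words $u,v,w$: (i) if $\overline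 pu=v\overline q=w$ and $v$ is shorter than $\overline p$, then $pu-vq\equiv0\bmod(S;w)$; (ii) if $u\ne1$ and $u\overline pv=\overline q=w$, then $upv-q\equiv0\bmod(S;w)$. It is a Gröbner–Shirshov basis for $\mathbb C[G]$ if moreover the natural homomorphism $\mathbb C\langle X\rangle\to\mathbb C[G]$, $s_i\mapsto s_i$, is surjective with kernel the two-sided ideal generated by $S$. **The set $\widehat R$.** Put $x=s_3s_2s_1$, $y=xs_2$, $z=ys_1$, and $$a=s_4s_3s_2,\quad b=as_1,\quad c=bs_2,\quad d=cs_3,\quad e=cs_1,\quad f=es_3,\quad g=fs_2,\quad h=gs_1,\quad k=hs_2,\quad m=ks_3.$$ Let $\widehat R\subset\mathbb C\langle X\rangle$ be the set of the following $84$ elements. 1. Defining relations: $s_1^2-1$, $s_2^2-1$, $s_3^2-1$, $s_4^2-1$, $s_2s_1s_2s_1s_2-s_1s_2s_1s_2s_1$, $s_3s_2s_3-s_2s_3s_2$, $s_4s_3s_4-s_3s_4s_3$, $s_3s_1-s_1s_3$, $s_4s_1-s_1s_4$, $s_4s_2-s_2s_4$. 2. Relations of type $H_3$: $xs_3-s_2x$,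 $xs_3s_2-s_2y$, $x^2-s_2z$, $ys_3s_2-s_2ys_3$, $ys_3s_2s_1-s_2zs_3$, $y^2-s_2zs_3s_2$, $z^2-s_2zy$. 3. $as_4-s_3a$, $as_4s_3-s_3s_2a$, $bs_4-s_3b$, $bs_4s_3-s_3s_2b$, $ba-s_3s_2c$, $b^2-s_3s_2e$, $cs_4-s_3c$, $cs_4s_3-s_3d$, $ca-s_3s_2d$, $cb-s_3s_2f$, $c^2-s_3s_2g$, $ds_2-s_2d$, $ds_4s_3-s_3ds_4$, $da-s_3s_2ds_4$, $db-s_3s_2fs_4$, $dc-s_3s_2gs_4$, $d^2-s_3s_2gs_4s_3$, $es_4-s_3e$, $es_4s_3-s_3f$, $ea-s_3g$, $eb-s_3h$, $ec-s_3k$, $ed-s_3m$, $e^2-s_3s_2k$, $fs_4s_3-s_3fs_4$, $fa-s_3gs_4$, $fb-s_3hs_4$, $fc-s_3ks_4$, $fd-s_3ks_4s_3$, $fe-s_3s_2ks_4$, $f^2-s_3s_2ks_4s_3$, $ga-s_3gs_4s_3$, $gb-s_3hs_4s_3$, $gc-s_3ha$, $gd-s_3ka$, $ge-s_3hb$, $gf-s_3kb$,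 $g^2-s_3kc$, $he-s_3hc$, $hf-s_3hd$, $hg-s_3kd$, $h^2-s_3kf$, $k^2-s_3kh$. 4. $kds_4s_3-mds_4$, $kfs_4s_3-mfs_4$, $kga-mgs_4s_3$, $khe-mhc$, $khds_4s_3-s_2khds_4$, $ms_1-s_2m$, $ms_2-s_1m$, $mds_4s_3-kds_4$, $mfs_4s_3-kfs_4$, $mga-kgs_4s_3$, $mhe-khc$, $mkh-s_3mkg$, $mkds_4s_3-m^2ds_4$, $mkfs_4s_3-m^2fs_4$, $mkga-m^2gs_4s_3$, $m^2hc-s_3m^2hb$, $m^2kd-s_3m^2kc$, $m^2kf-s_3m^2ke$, $m^3ds_4-s_3m^3d$, $m^3fs_4-s_3m^3f$, $m^3gs_4-s_3m^3g$, $m^3hs_4-s_3m^3h$, $m^3ks_4-s_3m^3k$, $m^4s_4s_3-s_3m^4s_4$. **The words.** Let $\mathcal M_2$ be the list of the $10$ words $1$, $s_1$, $s_2$, $s_1s_2$, $s_2s_1$, $s_1s_2s_1$, $s_2s_1s_2$, $s_1s_2s_1s_2$, $s_2s_1s_2s_1$, $s_1s_2s_1s_2s_1$. Let $\mathcal M_3$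 be the list of the $12$ words $1$, $s_3$, $s_3s_2$, $x$, $y$, $z$, $ys_3$, $zs_3$, $zs_3s_2$, $zx$, $zy$, $zys_3$. Let $t_1,\dots,t_{22}$ be, in this order, the words $1$, $s_4$, $s_4s_3$, $a$, $b$, $c$, $d$, $ds_4$, $e$, $f$, $fs_4$, $g$, $gs_4$, $gs_4s_3$, $h$, $hs_4$, $hs_4s_3$, $ha$, $hb$, $hc$, $hd$, $hds_4$. Let $\mathcal M_4$ be the list of the following $120$ words: $t_i$, $kt_i$ and $mt_i$ for $1\le i\le22$; $mkt_i$ for $1\le i\le14$; $m^2t_i$ for $1\le i\le19$; $m^2kt$ for $t\in\{1,s_4,s_4s_3,a,b,c,e\}$; $m^3t$ for $t\in\{1,s_4,s_4s_3,a,b,c,d,e,f,g,h,k\}$; and $m^4$, $m^4s_4$. **Theorem.** The elements of $\widehat R$ are monic, and $\widehat R$ is a Gröbner–Shirshov basis for $\mathbb C[G]$ with respect to the degree-lexicographic order, which is a monomial order (a well-ordering such that $u<v$ implies $puq<pvq$ for all words $p,q$). The $\widehat R$-standard words are exactly the products $M_2M_3M_4$ with $M_2\in\mathcal M_2$, $M_3\in\mathcal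 M_3$, $M_4\in\mathcal M_4$. There are exactly $10\cdot12\cdot120=14400=|G|$ of them, and their images form a basis of the complex vector space $\mathbb C[G]$. -/

import Mathlib

/-! ### Gröbner–Shirshov bases in free associative algebras

The free associative algebra `F⟨X⟩` is the monoid algebra of the free monoid `⟨X⟩` on `X`; a word
`u` is regarded as the element `MonoidAlgebra.of F _ u`. Monomial orders are strict orders `lt`. -/

namespace GroebnerShirshov

open MonoidAlgebra

variable {F X : Type*} [Field F]

/-- A monomial order: a well-ordering of the words that is compatible with multiplication. -/
structure IsMonomialOrder (lt : FreeMonoid X → FreeMonoid X → Prop) : Prop where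
  isWellOrder : IsWellOrder (FreeMonoid X) lt
  mul_lt_mul : ∀ x y : FreeMonoid X, lt x y → ∀ a b, lt (a * x * b) (a * y * b)

/-- The degree-lexicographic order: compare lengths first, then lexicographically from the left. -/
def DegLex [LinearOrder X] (u v : FreeMonoid X) : Prop :=
  List.Shortlex (· < ·) (FreeMonoid.toList u) (FreeMonoid.toList v)

/-- `w` is the leading monomial of `p`, the maximal word that occurs in `p`. -/
def IsLeading (lt : FreeMonoid X → FreeMonoid X → Prop) (p : MonoidAlgebra F (FreeMonoid X))
    (w : FreeMonoid X) : Prop :=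
  p.coeff w ≠ 0 ∧ ∀ v, p.coeff v ≠ 0 → v ≠ w → lt v w

/-- `p` is nonzero with leading coefficient `1`. -/
def IsMonic (lt : FreeMonoid X → FreeMonoid X → Prop) (p : MonoidAlgebra F (FreeMonoid X)) : Prop :=
  ∃ w, IsLeading lt p w ∧ p.coeff w = 1

/-- The word `u` is `S`-standard: it has no leading monomial of an element of `S` as a factor. -/
def IsStandard (lt : FreeMonoid X → FreeMonoid X → Prop)
    (S : Set (MonoidAlgebra F (FreeMonoid X))) (u : FreeMonoid X) : Prop :=
  ∀ s ∈ S, ∀ w, IsLeading lt s w → ∀ a b, u ≠ a * w * b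

/-- `p ≡ q mod (S; w)`: the difference is a linear combination of elements `a s b` with `s ∈ S`,
words `a`, `b`, and `a * (leading monomial of s) * b < w`. -/
def CongrMod (lt : FreeMonoid X → FreeMonoid X → Prop) (S : Set (MonoidAlgebra F (FreeMonoid X)))
    (w : FreeMonoid X) (p q : MonoidAlgebra F (FreeMonoid X)) : Prop :=
  p - q ∈ Submodule.span F {f | ∃ s ∈ S, ∃ v, IsLeading lt s v ∧
    ∃ a b, lt (a * v * b) w ∧ f = of F _ a * s * of F _ b}

/-- All compositions of intersection and of inclusion of elements of `S` are trivial. -/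
structure ClosedUnderComposition (lt : FreeMonoid X → FreeMonoid X → Prop)
    (S : Set (MonoidAlgebra F (FreeMonoid X))) : Prop where
  intersection : ∀ p ∈ S, ∀ q ∈ S, ∀ u v, IsLeading lt p u → IsLeading lt q v →
    ∀ a b w, u * a = w → b * v = w → b.length < u.length →
      CongrMod lt S w (p * of F _ a - of F _ b * q) 0
  inclusion : ∀ p ∈ S, ∀ q ∈ S, ∀ u v, IsLeading lt p u → IsLeading lt q v →
    ∀ a b w, a ≠ 1 → a * u * b = w → v = w →
      CongrMod lt S w (of F _ a * p * of F _ b - q) 0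

/-- `S` is a Gröbner–Shirshov basis with respect to the monomial order `lt`. -/
structure IsGSBasis (lt : FreeMonoid X → FreeMonoid X → Prop)
    (S : Set (MonoidAlgebra F (FreeMonoid X))) : Prop where
  isMonomialOrder : IsMonomialOrder lt
  isMonic : ∀ s ∈ S, IsMonic lt s
  closed : ClosedUnderComposition lt S

/-- `S` is a Gröbner–Shirshov basis for the algebra `A`, where `A` is generated by `X` through
`π : F⟨X⟩ → A`: moreover `A` is the algebra defined by `S`, i.e. `π` is onto and its kernel is the
two-sided ideal generated by `S`. -/
structure IsGSBasisFor {A : Type*} [Ring A] [Algebra F A]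
    (lt : FreeMonoid X → FreeMonoid X → Prop) (S : Set (MonoidAlgebra F (FreeMonoid X)))
    (π : MonoidAlgebra F (FreeMonoid X) →ₐ[F] A) : Prop where
  isGSBasis : IsGSBasis lt S
  surjective : Function.Surjective π
  ker_eq : TwoSidedIdeal.ker π = TwoSidedIdeal.span S

end GroebnerShirshov

/-! ### The Coxeter group of type `H₄` -/

namespace CoxeterH4

/-- Words in the generators `s₁ < s₂ < s₃ < s₄`, which are numbered `0 < 1 < 2 < 3` here. -/
abbrev Word : Type := FreeMonoid (Fin 4)

/-- The Coxeter group of type `H₄`. -/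
abbrev G : Type := CoxeterMatrix.H₄.Group

/-- The natural map `ℂ⟨s₁, s₂, s₃, s₄⟩ → ℂ[G]`. In `CoxeterMatrix.H₄` the label `5` is on the edge
between the last two nodes `2` and `3`, so that the numbering has to be reversed: with it,
`(s₁s₂)⁵ = (s₂s₃)³ = (s₃s₄)³ = 1` and other pairs commute. -/
noncomputable def toGroupAlgebra : MonoidAlgebra ℂ Word →ₐ[ℂ] MonoidAlgebra ℂ G :=
  MonoidAlgebra.lift ℂ (MonoidAlgebra ℂ G) Word
    (FreeMonoid.lift fun i : Fin 4 => MonoidAlgebra.of ℂ G (CoxeterMatrix.H₄.simple i.rev))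

def s1 : Word := FreeMonoid.of 0
def s2 : Word := FreeMonoid.of 1
def s3 : Word := FreeMonoid.of 2
def s4 : Word := FreeMonoid.of 3

def w321 : Word := s3 * s2 * s1
def w3212 : Word := s3 * s2 * s1 * s2
def w32121 : Word := s3 * s2 * s1 * s2 * s1

def w432 : Word := s4 * s3 * s2
def w4321 : Word := s4 * s3 * s2 * s1
def w43212 : Word := s4 * s3 * s2 * s1 * s2
def w432123 : Word := s4 * s3 * s2 * s1 * s2 * s3
def w432121 : Word := s4 * s3 * s2 * s1 * s2 * s1
def w4321213 : Word := s4 * s3 * s2 * s1 * s2 * s1 * s3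
def w43212132 : Word := s4 * s3 * s2 * s1 * s2 * s1 * s3 * s2
def w432121321 : Word := s4 * s3 * s2 * s1 * s2 * s1 * s3 * s2 * s1
def w4321213212 : Word := s4 * s3 * s2 * s1 * s2 * s1 * s3 * s2 * s1 * s2
def w43212132123 : Word := s4 * s3 * s2 * s1 * s2 * s1 * s3 * s2 * s1 * s2 * s3

/-! A pair `(u, v)` in the following lists stands for the polynomial `u - v`. -/

/-- The defining relations of `ℂ[G]`. -/
def relDefining : List (Word × Word) :=
  [(s1 ^ 2, 1), (s2 ^ 2, 1), (s3 ^ 2, 1), (s4 ^ 2, 1),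
   (s2 * s1 * s2 * s1 * s2, s1 * s2 * s1 * s2 * s1),
   (s3 * s2 * s3, s2 * s3 * s2), (s4 * s3 * s4, s3 * s4 * s3),
   (s3 * s1, s1 * s3), (s4 * s1, s1 * s4), (s4 * s2, s2 * s4)]

/-- Further relations that involve `s₁, s₂, s₃` only. -/
def relH3 : List (Word × Word) :=
  [(w321 * s3, s2 * w321),
   (w321 * s3 * s2, s2 * w3212),
   (w321 ^ 2, s2 * w32121),
   (w3212 * s3 * s2, s2 * w3212 * s3),
   (w3212 * s3 * s2 * s1, s2 * w32121 * s3),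
   (w3212 ^ 2, s2 * w32121 * s3 * s2),
   (w32121 ^ 2, s2 * w32121 * w3212)]

/-- Relations whose leading monomial contains `s₄` exactly twice, or once in the case of
`w432123 * s2`. -/
def relH4a : List (Word × Word) :=
  [(w432 * s4, s3 * w432),
   (w432 * s4 * s3, s3 * s2 * w432),
   (w4321 * s4, s3 * w4321),
   (w4321 * s4 * s3, s3 * s2 * w4321),
   (w4321 * w432, s3 * s2 * w43212),
   (w4321 ^ 2, s3 * s2 * w432121),
   (w43212 * s4, s3 * w43212),
   (w43212 * s4 * s3, s3 * w432123),
   (w43212 * w432, s3 * s2 * w432123),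
   (w43212 * w4321, s3 * s2 * w4321213),
   (w43212 ^ 2, s3 * s2 * w43212132),
   (w432123 * s2, s2 * w432123),
   (w432123 * s4 * s3, s3 * w432123 * s4),
   (w432123 * w432, s3 * s2 * w432123 * s4),
   (w432123 * w4321, s3 * s2 * w4321213 * s4),
   (w432123 * w43212, s3 * s2 * w43212132 * s4),
   (w432123 ^ 2, s3 * s2 * w43212132 * s4 * s3),
   (w432121 * s4, s3 * w432121),
   (w432121 * s4 * s3, s3 * w4321213),
   (w432121 * w432, s3 * w43212132),
   (w432121 * w4321, s3 * w432121321),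
   (w432121 * w43212, s3 * w4321213212),
   (w432121 * w432123, s3 * w43212132123),
   (w432121 ^ 2, s3 * s2 * w4321213212),
   (w4321213 * s4 * s3, s3 * w4321213 * s4),
   (w4321213 * w432, s3 * w43212132 * s4),
   (w4321213 * w4321, s3 * w432121321 * s4),
   (w4321213 * w43212, s3 * w4321213212 * s4),
   (w4321213 * w432123, s3 * w4321213212 * s4 * s3),
   (w4321213 * w432121, s3 * s2 * w4321213212 * s4),
   (w4321213 ^ 2, s3 * s2 * w4321213212 * s4 * s3),
   (w43212132 * w432, s3 * w43212132 * s4 * s3),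
   (w43212132 * w4321, s3 * w432121321 * s4 * s3),
   (w43212132 * w43212, s3 * w432121321 * w432),
   (w43212132 * w432123, s3 * w4321213212 * w432),
   (w43212132 * w432121, s3 * w432121321 * w4321),
   (w43212132 * w4321213, s3 * w4321213212 * w4321),
   (w43212132 ^ 2, s3 * w4321213212 * w43212),
   (w432121321 * w432121, s3 * w432121321 * w43212),
   (w432121321 * w4321213, s3 * w432121321 * w432123),
   (w432121321 * w43212132, s3 * w4321213212 * w432123),
   (w432121321 ^ 2, s3 * w4321213212 * w4321213),
   (w4321213212 ^ 2, s3 * w4321213212 * w432121321)]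

/-- The remaining relations. -/
def relH4b : List (Word × Word) :=
  [(w4321213212 * w432123 * s4 * s3, w43212132123 * w432123 * s4),
   (w4321213212 * w4321213 * s4 * s3, w43212132123 * w4321213 * s4),
   (w4321213212 * w43212132 * w432, w43212132123 * w43212132 * s4 * s3),
   (w4321213212 * w432121321 * w432121, w43212132123 * w432121321 * w43212),
   (w4321213212 * w432121321 * w432123 * s4 * s3, s2 * w4321213212 * w432121321 * w432123 * s4),
   (w43212132123 * s1, s2 * w43212132123),
   (w43212132123 * s2, s1 * w43212132123),
   (w43212132123 * w432123 * s4 * s3, w4321213212 * w432123 * s4),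
   (w43212132123 * w4321213 * s4 * s3, w4321213212 * w4321213 * s4),
   (w43212132123 * w43212132 * w432, w4321213212 * w43212132 * s4 * s3),
   (w43212132123 * w432121321 * w432121, w4321213212 * w432121321 * w43212),
   (w43212132123 * w4321213212 * w432121321, s3 * w43212132123 * w4321213212 * w43212132),
   (w43212132123 * w4321213212 * w432123 * s4 * s3, w43212132123 ^ 2 * w432123 * s4),
   (w43212132123 * w4321213212 * w4321213 * s4 * s3, w43212132123 ^ 2 * w4321213 * s4),
   (w43212132123 * w4321213212 * w43212132 * w432, w43212132123 ^ 2 * w43212132 * s4 * s3),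
   (w43212132123 ^ 2 * w432121321 * w43212, s3 * w43212132123 ^ 2 * w432121321 * w4321),
   (w43212132123 ^ 2 * w4321213212 * w432123, s3 * w43212132123 ^ 2 * w4321213212 * w43212),
   (w43212132123 ^ 2 * w4321213212 * w4321213, s3 * w43212132123 ^ 2 * w4321213212 * w432121),
   (w43212132123 ^ 3 * w432123 * s4, s3 * w43212132123 ^ 3 * w432123),
   (w43212132123 ^ 3 * w4321213 * s4, s3 * w43212132123 ^ 3 * w4321213),
   (w43212132123 ^ 3 * w43212132 * s4, s3 * w43212132123 ^ 3 * w43212132),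
   (w43212132123 ^ 3 * w432121321 * s4, s3 * w43212132123 ^ 3 * w432121321),
   (w43212132123 ^ 3 * w4321213212 * s4, s3 * w43212132123 ^ 3 * w4321213212),
   (w43212132123 ^ 4 * s4 * s3, s3 * w43212132123 ^ 4 * s4)]

/-- The set `R̂` of all these relations, as a subset of `ℂ⟨s₁, s₂, s₃, s₄⟩`. -/
def RHat : Set (MonoidAlgebra ℂ Word) :=
  {p | ∃ r ∈ relDefining ++ relH3 ++ relH4a ++ relH4b,
    p = MonoidAlgebra.of ℂ Word r.1 - MonoidAlgebra.of ℂ Word r.2}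

/-- The possible left factors `M₂`. -/
def words2 : List Word :=
  [1, s1, s2, s1 * s2, s2 * s1, s1 * s2 * s1, s2 * s1 * s2, s1 * s2 * s1 * s2, s2 * s1 * s2 * s1,
   s1 * s2 * s1 * s2 * s1]

/-- The possible middle factors `M₃`. -/
def words3 : List Word :=
  [1, s3, s3 * s2, w321, w3212, w32121, w3212 * s3, w32121 * s3,
   w32121 * (s3 * s2), w32121 * w321, w32121 * w3212, w32121 * w3212 * s3]

/-- The first `22` of the possible right factors `M₄`. -/
def words4Init : List Word :=
  [1, s4, s4 * s3, w432, w4321, w43212, w432123, w432123 * s4, w432121, w4321213, w4321213 * s4,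
   w43212132, w43212132 * s4, w43212132 * s4 * s3,
   w432121321, w432121321 * s4, w432121321 * s4 * s3, w432121321 * w432, w432121321 * w4321,
   w432121321 * w43212, w432121321 * w432123, w432121321 * w432123 * s4]

/-- The possible right factors `M₄`. -/
def words4 : List Word :=
  words4Init
  ++ words4Init.map (w4321213212 * ·)
  ++ words4Init.map (w43212132123 * ·)
  ++ (words4Init.take 14).map (w43212132123 * w4321213212 * ·)
  ++ (words4Init.take 19).map (w43212132123 ^ 2 * ·)
  ++ [1, s4, s4 * s3, w432, w4321, w43212, w432121].map (w43212132123 ^ 2 * w4321213212 * ·)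
  ++ [1, s4, s4 * s3, w432, w4321, w43212, w432123, w432121, w4321213, w43212132, w432121321,
      w4321213212].map (w43212132123 ^ 3 * ·)
  ++ [1, s4].map (w43212132123 ^ 4 * ·)

end CoxeterH4

/-! ### Binomial Gröbner–Shirshov bases of monoid algebras -/

/-! The compositions of the 84 relations are never computed one by one. Suppose oriented binomials
`u - v` hold in a monoid `M`, and distinct standard words have distinct images in `M`. A composition
at `w` is then a difference of two words below `w` with the same image. Each reduces, through words
below `w`, to a standard word, and the two standard words coincide by injectivity. The same
injectivity gives the kernel of the map to the monoid algebra and the linear independence of the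
standard words (`isGSBasis_binomials`, `isGSBasisFor_binomials`).

For `H₄` this leaves three things to check. Relations: 22 consequences of the defining relations are
obtained from critical pairs, as in Knuth–Bendix completion; with them both sides of each of the 84
relations reduce to the same word (`reduce_eq_reduce`). Upper bound: appending a letter to a product
`M₂M₃M₄` gives a reducible suffix or another product, so every standard word is a product
(`mem_products_of_forall_ne`). Separation: the products have distinct images in `G`. Their factors
represent cosets along a chain of parabolic subgroups, and the reflection representation over `ZMod
11` tells these cosets apart (`eq_of_wordProd_eq`).

Each product has the same image as some standard word, which is itself a product, so the two are
equal. Hence the standard words are exactly the products; the order of `G` is a consequence, not an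
input. -/

namespace GroebnerShirshov

open MonoidAlgebra

section Binomials

variable {F X : Type*} [Field F] {lt : FreeMonoid X → FreeMonoid X → Prop}

/-- The binomials `u - v` for the pairs `(u, v)` in `R`. -/
def binomials (F : Type*) [Field F] (R : Set (FreeMonoid X × FreeMonoid X)) :
    Set (MonoidAlgebra F (FreeMonoid X)) :=
  {p | ∃ r ∈ R, p = of F _ r.1 - of F _ r.2}

theorem IsMonomialOrder.irrefl (h : IsMonomialOrder lt) (u : FreeMonoid X) : ¬ lt u u :=
  have := h.isWellOrder
  irrefl_of lt u

theorem IsMonomialOrder.trans (h : IsMonomialOrder lt) {u v w : FreeMonoid X}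
    (huv : lt u v) (hvw : lt v w) : lt u w :=
  have := h.isWellOrder
  _root_.trans huv hvw

theorem IsMonomialOrder.ne (h : IsMonomialOrder lt) {u v : FreeMonoid X} (huv : lt u v) : u ≠ v :=
  fun he => h.irrefl v (he ▸ huv)

theorem IsLeading.unique (h : IsMonomialOrder lt) {p : MonoidAlgebra F (FreeMonoid X)}
    {u v : FreeMonoid X} (hu : IsLeading lt p u) (hv : IsLeading lt p v) : u = v := by
  by_contra hne
  exact h.irrefl u (h.trans (hv.2 u hu.1 hne) (hu.2 v hv.1 (Ne.symm hne)))

theorem coeff_of_sub_of_left {u v : FreeMonoid X} (huv : v ≠ u) :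
    (of F _ u - of F _ v).coeff u = 1 := by
  classical
  simp [huv]

theorem isLeading_of_sub_of (h : IsMonomialOrder lt) {u v : FreeMonoid X} (hvu : lt v u) :
    IsLeading lt (of F _ u - of F _ v) u := by
  classical
  refine ⟨by rw [coeff_of_sub_of_left (h.ne hvu)]; exact one_ne_zero, fun w hw hwu => ?_⟩
  by_cases hwv : v = w
  · exact hwv ▸ hvu
  · simp [hwv, Ne.symm hwu] at hw

theorem CongrMod.refl (S : Set (MonoidAlgebra F (FreeMonoid X))) (w : FreeMonoid X)
    (p : MonoidAlgebra F (FreeMonoid X)) : CongrMod lt S w p p := by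
  simp [CongrMod]

theorem CongrMod.trans {S : Set (MonoidAlgebra F (FreeMonoid X))} {w : FreeMonoid X}
    {p q r : MonoidAlgebra F (FreeMonoid X)} (hpq : CongrMod lt S w p q)
    (hqr : CongrMod lt S w q r) : CongrMod lt S w p r := by
  simpa [CongrMod] using Submodule.add_mem _ hpq hqr

theorem CongrMod.symm {S : Set (MonoidAlgebra F (FreeMonoid X))} {w : FreeMonoid X}
    {p q : MonoidAlgebra F (FreeMonoid X)} (hpq : CongrMod lt S w p q) : CongrMod lt S w q p := by
  simpa [CongrMod] using Submodule.neg_mem _ hpq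

variable {R : Set (FreeMonoid X × FreeMonoid X)}

theorem IsLeading.exists_of_mem_binomials (h : IsMonomialOrder lt) (hR : ∀ r ∈ R, lt r.2 r.1)
    {s : MonoidAlgebra F (FreeMonoid X)} (hs : s ∈ binomials F R) {w : FreeMonoid X}
    (hw : IsLeading lt s w) : ∃ v, (w, v) ∈ R ∧ s = of F _ w - of F _ v := by
  obtain ⟨r, hr, rfl⟩ := hs
  obtain rfl := hw.unique h (isLeading_of_sub_of h (hR r hr))
  exact ⟨r.2, hr, rfl⟩

theorem isStandard_binomials_iff (h : IsMonomialOrder lt) (hR : ∀ r ∈ R, lt r.2 r.1)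
    {u : FreeMonoid X} :
    IsStandard lt (binomials F R) u ↔ ∀ r ∈ R, ∀ a b, u ≠ a * r.1 * b := by
  constructor
  · intro hu r hr
    exact hu _ ⟨r, hr, rfl⟩ r.1 (isLeading_of_sub_of h (hR r hr))
  · intro hu s hs w hw
    obtain ⟨v, hv, -⟩ := hw.exists_of_mem_binomials h hR hs
    exact hu _ hv

theorem congrMod_of_mul_mul (h : IsMonomialOrder lt) (hR : ∀ r ∈ R, lt r.2 r.1)
    {r : FreeMonoid X × FreeMonoid X} (hr : r ∈ R) {a b w : FreeMonoid X}
    (hw : lt (a * r.1 * b) w) :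
    CongrMod lt (binomials F R) w (of F _ (a * r.1 * b)) (of F _ (a * r.2 * b)) :=
  Submodule.subset_span ⟨_, ⟨r, hr, rfl⟩, r.1, isLeading_of_sub_of h (hR r hr), a, b, hw, by
    simp [mul_sub, sub_mul]⟩

variable {M : Type*} [Monoid M] {φ : FreeMonoid X →* M}

/-- Every word reduces to a standard word that represents the same element. -/
theorem exists_isStandard (h : IsMonomialOrder lt) (hR : ∀ r ∈ R, lt r.2 r.1)
    (hφ : ∀ r ∈ R, φ r.1 = φ r.2) (w : FreeMonoid X) :
    ∃ n, IsStandard lt (binomials F R) n ∧ φ n = φ w ∧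
      of F _ w - of F _ n ∈ TwoSidedIdeal.span (binomials F R) ∧
      ∀ w', lt w w' → CongrMod lt (binomials F R) w' (of F _ w) (of F _ n) := by
  have := h.isWellOrder
  induction w using (IsWellFounded.wf (r := lt)).induction with
  | _ w ih =>
    by_cases hw : IsStandard lt (binomials F R) w
    · exact ⟨w, hw, rfl, by simp, fun w' _ => CongrMod.refl _ _ _⟩
    · simp only [isStandard_binomials_iff h hR, not_forall, not_not] at hw
      obtain ⟨r, hr, a, b, rfl⟩ := hw
      have hlt := h.mul_lt_mul _ _ (hR r hr) a b
      obtain ⟨n, hn, hφn, hI, hc⟩ := ih _ hlt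
      refine ⟨n, hn, by rw [hφn]; simp [hφ r hr], ?_, fun w' hw' => ?_⟩
      · have h₁ := TwoSidedIdeal.mul_mem_right _ _ (of F _ b) (TwoSidedIdeal.mul_mem_left _
          (of F _ a) _ (TwoSidedIdeal.subset_span (s := binomials F R) ⟨r, hr, rfl⟩))
        convert TwoSidedIdeal.add_mem _ h₁ hI using 1
        simp [mul_sub, sub_mul]
      · exact (congrMod_of_mul_mul h hR hr hw').trans (hc w' (h.trans hlt hw'))

theorem congrMod_of_of (h : IsMonomialOrder lt) (hR : ∀ r ∈ R, lt r.2 r.1)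
    (hφ : ∀ r ∈ R, φ r.1 = φ r.2) (hinj : Set.InjOn φ {u | IsStandard lt (binomials F R) u})
    {x y w : FreeMonoid X} (hx : lt x w) (hy : lt y w) (hxy : φ x = φ y) :
    CongrMod lt (binomials F R) w (of F _ x) (of F _ y) := by
  obtain ⟨m, hm, hφm, -, hcm⟩ := exists_isStandard (F := F) h hR hφ x
  obtain ⟨n, hn, hφn, -, hcn⟩ := exists_isStandard (F := F) h hR hφ y
  obtain rfl : m = n := hinj hm hn (by rw [hφm, hφn, hxy])
  exact (hcm w hx).trans (hcn w hy).symm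

/-- Oriented relations that hold in a monoid form a Gröbner–Shirshov basis if distinct standard
words represent distinct elements of the monoid. -/
theorem isGSBasis_binomials (h : IsMonomialOrder lt) (hR : ∀ r ∈ R, lt r.2 r.1)
    (hφ : ∀ r ∈ R, φ r.1 = φ r.2) (hinj : Set.InjOn φ {u | IsStandard lt (binomials F R) u}) :
    IsGSBasis lt (binomials F R) where
  isMonomialOrder := h
  isMonic := by
    rintro _ ⟨r, hr, rfl⟩
    exact ⟨r.1, isLeading_of_sub_of h (hR r hr), coeff_of_sub_of_left (h.ne (hR r hr))⟩
  closed := by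
    -- Both kinds of composition come from one word `w` that contains two leading monomials:
    -- replacing either one gives a word below `w` with the image of `w`.
    have key : ∀ {u u' v v' a b c d w : FreeMonoid X}, (u, u') ∈ R → (v, v') ∈ R →
        a * u * b = w → c * v * d = w → CongrMod lt (binomials F R) w
          (of F _ (c * v' * d)) (of F _ (a * u' * b)) := by
      intro u u' v v' a b c d w hu hv huw hvw
      refine congrMod_of_of h hR hφ hinj (hvw ▸ h.mul_lt_mul _ _ (hR _ hv) c d)
        (huw ▸ h.mul_lt_mul _ _ (hR _ hu) a b) ?_
      have h₁ := congrArg φ (huw.trans hvw.symm)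
      simp only [map_mul, hφ _ hu, hφ _ hv] at h₁ ⊢
      exact h₁.symm
    constructor
    · intro p hp q hq u v hu hv a b w hua hbv _
      obtain ⟨u', hu', rfl⟩ := hu.exists_of_mem_binomials h hR hp
      obtain ⟨v', hv', rfl⟩ := hv.exists_of_mem_binomials h hR hq
      have := key (a := 1) (b := a) (c := b) (d := 1) hu' hv' (by simpa using hua)
        (by simpa using hbv)
      simp only [one_mul, mul_one] at this
      unfold CongrMod at this ⊢
      convert this using 1
      simp only [sub_mul, mul_sub, ← map_mul, hua, hbv]
      abel
    · intro p hp q hq u v hu hv a b w _ huw hvw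
      obtain ⟨u', hu', rfl⟩ := hu.exists_of_mem_binomials h hR hp
      obtain ⟨v', hv', rfl⟩ := hv.exists_of_mem_binomials h hR hq
      have := key (a := a) (b := b) (c := 1) (d := 1) hu' hv' huw (by simpa using hvw)
      simp only [one_mul, mul_one] at this
      unfold CongrMod at this ⊢
      convert this using 1
      simp only [sub_mul, mul_sub, ← map_mul, huw, hvw]
      abel

theorem bijOn_isStandard (h : IsMonomialOrder lt) (hR : ∀ r ∈ R, lt r.2 r.1)
    (hφ : ∀ r ∈ R, φ r.1 = φ r.2) (hinj : Set.InjOn φ {u | IsStandard lt (binomials F R) u})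
    (hsurj : Function.Surjective φ) :
    Set.BijOn φ {u | IsStandard lt (binomials F R) u} Set.univ := by
  refine ⟨Set.mapsTo_univ _ _, hinj, fun g _ => ?_⟩
  obtain ⟨w, rfl⟩ := hsurj g
  obtain ⟨n, hn, hφn, -⟩ := exists_isStandard (F := F) h hR hφ w
  exact ⟨n, hn, hφn⟩

/-- Moreover they form a Gröbner–Shirshov basis for the monoid algebra if the words represent all
elements of the monoid. -/
theorem isGSBasisFor_binomials (h : IsMonomialOrder lt) (hR : ∀ r ∈ R, lt r.2 r.1)
    (hφ : ∀ r ∈ R, φ r.1 = φ r.2) (hinj : Set.InjOn φ {u | IsStandard lt (binomials F R) u})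
    (hsurj : Function.Surjective φ) :
    IsGSBasisFor lt (binomials F R) (mapDomainAlgHom F F φ) where
  isGSBasis := isGSBasis_binomials h hR hφ hinj
  surjective x := by
    induction x using MonoidAlgebra.induction_linear with
    | zero => exact ⟨0, map_zero _⟩
    | add x y hx hy =>
      obtain ⟨x, rfl⟩ := hx
      obtain ⟨y, rfl⟩ := hy
      exact ⟨x + y, map_add _ _ _⟩
    | single g c =>
      obtain ⟨w, rfl⟩ := hsurj g
      exact ⟨single w c, by simp⟩
  ker_eq := by
    apply le_antisymm
    · have hσ : ∀ g : M, ∃ n, IsStandard lt (binomials F R) n ∧ φ n = g := fun g => by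
        obtain ⟨n, hn, hφn⟩ := (bijOn_isStandard h hR hφ hinj hsurj).surjOn (Set.mem_univ g)
        exact ⟨n, hn, hφn⟩
      choose σ hσs hσφ using hσ
      -- Modulo the ideal, `x` equals a combination of standard words that depends only on the image
      -- of `x`; if the image vanishes, `x` lies in the ideal.
      have key : ∀ x : MonoidAlgebra F (FreeMonoid X),
          x - mapDomain σ (mapDomain φ x) ∈ TwoSidedIdeal.span (binomials F R) := fun x => by
        induction x using MonoidAlgebra.induction_linear with
        | zero => simp
        | add x y hx hy =>
          rw [mapDomain_add, mapDomain_add, add_sub_add_comm]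
          exact TwoSidedIdeal.add_mem _ hx hy
        | single w c =>
          obtain ⟨n, hn, hφn, hwn, -⟩ := exists_isStandard (F := F) h hR hφ w
          obtain rfl : σ (φ w) = n := hinj (hσs _) hn (by rw [hσφ, hφn])
          convert TwoSidedIdeal.mul_mem_left _ (algebraMap F _ c) _ hwn using 1
          simp [mul_sub]
      intro x hx
      have hx' : mapDomain φ x = 0 := by simpa [TwoSidedIdeal.mem_ker] using hx
      simpa [hx'] using key x
    · rw [TwoSidedIdeal.span_le]
      rintro _ ⟨r, hr, rfl⟩
      rw [SetLike.mem_coe, TwoSidedIdeal.mem_ker, map_sub]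
      simp [hφ r hr]

theorem linearIndependent_isStandard (hinj : Set.InjOn φ {u | IsStandard lt (binomials F R) u}) :
    LinearIndependent F (fun u : {u : FreeMonoid X // IsStandard lt (binomials F R) u} =>
      mapDomainAlgHom F F φ (of F _ u.1)) := by
  have := (MonoidAlgebra.basis M F).linearIndependent.comp
    (fun u : {u : FreeMonoid X // IsStandard lt (binomials F R) u} => φ u.1)
    fun u v huv => Subtype.ext (hinj u.2 v.2 huv)
  simpa [Function.comp_def] using this

theorem span_isStandard (h : IsMonomialOrder lt) (hR : ∀ r ∈ R, lt r.2 r.1)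
    (hφ : ∀ r ∈ R, φ r.1 = φ r.2) (hsurj : Function.Surjective φ) :
    Submodule.span F (Set.range fun u : {u : FreeMonoid X // IsStandard lt (binomials F R) u} =>
      mapDomainAlgHom F F φ (of F _ u.1)) = ⊤ := by
  rw [eq_top_iff, ← (MonoidAlgebra.basis M F).span_eq]
  refine Submodule.span_mono ?_
  rintro _ ⟨g, rfl⟩
  obtain ⟨w, rfl⟩ := hsurj g
  obtain ⟨n, hn, hφn, -⟩ := exists_isStandard (F := F) h hR hφ w
  exact ⟨⟨n, hn⟩, by simp [hφn]⟩

end Binomials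

/-! ### The degree-lexicographic order is a monomial order -/

/-- Equal lengths exclude the case of a proper prefix, in which appending letters can reverse the
comparison. -/
theorem lex_append_append {α : Type*} {r : α → α → Prop} {s t : List α}
    (hl : s.length = t.length) (h : List.Lex r s t) (l : List α) :
    List.Lex r (s ++ l) (t ++ l) := by
  induction h with
  | nil => simp at hl
  | cons _ ih => exact .cons (ih (by simpa using hl))
  | rel h => exact .rel h

theorem isMonomialOrder_degLex {X : Type*} [LinearOrder X] [WellFoundedLT X] :
    IsMonomialOrder (DegLex (X := X)) where
  isWellOrder := by
    have h₁ : IsWellFounded (List X) (List.Shortlex (· < ·)) := ⟨List.Shortlex.wf wellFounded_lt⟩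
    have h₂ : Std.Trichotomous (List.Shortlex (α := X) (· < ·)) := List.Shortlex.trichotomous
    exact { toIsWellFounded := h₁, toTrichotomous := h₂ }
  mul_lt_mul x y hxy a b := by
    have h : List.Shortlex (· < ·) (FreeMonoid.toList x ++ FreeMonoid.toList b)
        (FreeMonoid.toList y ++ FreeMonoid.toList b) := by
      rcases List.shortlex_def.mp hxy with hl | ⟨hl, hlex⟩
      · exact .of_length_lt (by simpa using hl)
      · exact .of_lex (by simpa using hl) (lex_append_append hl hlex _)
    simpa [DegLex, mul_assoc] using h.append_left (FreeMonoid.toList a)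

end GroebnerShirshov

/-! ### Derivation of relations by string rewriting -/

namespace StringRewriting

open FreeMonoid

variable {α : Type*} [DecidableEq α]

/-- Apply the first rule whose left side ends the word with the reversal `stack`; the result is the
reversal of the remaining word, together with the right side of the rule. -/
def rewriteTop (rules : List (FreeMonoid α × FreeMonoid α)) (stack : List α) :
    Option (List α × List α) :=
  rules.findSome? fun r =>
    (stack.dropPrefix? (toList r.1).reverse).map fun t => (t, toList r.2)

/-- Reduce the word `stack.reverse ++ input` in at most `fuel` steps, from the left. -/
def reduce (rules : List (FreeMonoid α × FreeMonoid α)) :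
    (fuel : ℕ) → (stack input : List α) → List α
  | 0, stack, input => stack.reverse ++ input
  | _ + 1, stack, [] => stack.reverse
  | fuel + 1, stack, x :: input =>
    match rewriteTop rules (x :: stack) with
    | none => reduce rules fuel (x :: stack) input
    | some (stack', v) => reduce rules fuel stack' (v ++ input)

/-- The words `toList p.1` and `toList q.1` overlap in `n` letters, and reduction of the
two sides of the critical pair yields `u` and `v`. -/
def IsCriticalPair (rules : List (FreeMonoid α × FreeMonoid α)) (fuel : ℕ)
    (p q : FreeMonoid α × FreeMonoid α) (n : ℕ) (u v : FreeMonoid α) : Prop :=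
  toList p.1 = (toList p.1).take ((toList p.1).length - n) ++ (toList q.1).take n ∧
  reduce rules fuel [] ((toList p.1).take ((toList p.1).length - n) ++ toList q.2) = toList u ∧
  reduce rules fuel [] (toList p.2 ++ (toList q.1).drop n) = toList v

/-- Every relation in `steps` comes from a critical pair of the preceding relations; the triple
`(i, j, n)` gives the positions of the two relations and the length of the overlap. -/
def IsDerivation (fuel : ℕ) : List (FreeMonoid α × FreeMonoid α) →
    List ((ℕ × ℕ × ℕ) × FreeMonoid α × FreeMonoid α) → Prop
  | _, [] => True
  | rules, ((i, j, n), r) :: steps =>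
    (∃ p ∈ rules[i]?, ∃ q ∈ rules[j]?, IsCriticalPair rules fuel p q n r.1 r.2) ∧
      IsDerivation fuel (rules ++ [r]) steps

instance (rules : List (FreeMonoid α × FreeMonoid α)) (fuel : ℕ) (p q : FreeMonoid α × FreeMonoid α)
    (n : ℕ) (u v : FreeMonoid α) : Decidable (IsCriticalPair rules fuel p q n u v) :=
  inferInstanceAs (Decidable (_ ∧ _ ∧ _))

instance decidableIsDerivation (fuel : ℕ) (rules : List (FreeMonoid α × FreeMonoid α)) :
    (steps : List ((ℕ × ℕ × ℕ) × FreeMonoid α × FreeMonoid α)) →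
    Decidable (IsDerivation fuel rules steps)
  | [] => inferInstanceAs (Decidable True)
  | (_, r) :: steps =>
    have := decidableIsDerivation fuel (rules ++ [r]) steps
    inferInstanceAs (Decidable (_ ∧ _))

variable {M : Type*} [Monoid M] {φ : FreeMonoid α →* M}
  {rules : List (FreeMonoid α × FreeMonoid α)}

theorem map_rewriteTop (hφ : ∀ r ∈ rules, φ r.1 = φ r.2) {stack t v : List α}
    (h : rewriteTop rules stack = some (t, v)) :
    φ (ofList stack.reverse) = φ (ofList (t.reverse ++ v)) := by
  obtain ⟨r, hr, h⟩ := List.exists_of_findSome?_eq_some h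
  obtain ⟨t', h, heq⟩ := Option.map_eq_some_iff.mp h
  obtain ⟨p, rfl, hp⟩ := List.dropPrefix?_eq_some_iff.mp h
  obtain ⟨rfl, rfl⟩ := Prod.mk.inj heq
  rw [eq_of_beq hp]
  simp [hφ r hr]

/-- Every step preserves the image of `stack.reverse ++ input`, and this word is returned when the
fuel runs out. Soundness thus needs neither termination nor confluence of the rules. -/
theorem map_reduce (hφ : ∀ r ∈ rules, φ r.1 = φ r.2) (fuel : ℕ) (stack input : List α) :
    φ (ofList (reduce rules fuel stack input)) = φ (ofList (stack.reverse ++ input)) := by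
  induction fuel generalizing stack input with
  | zero => rfl
  | succ fuel ih =>
    match input with
    | [] => simp [reduce]
    | x :: input =>
      rw [reduce]
      split
      · rw [ih]
        simp
      · rename_i t v h
        have h := map_rewriteTop hφ h
        rw [ih]
        simp only [List.reverse_cons, ofList_append, map_mul] at h ⊢
        rw [← mul_assoc, ← h]
        simp [mul_assoc]

/-- Both `u` and `v` arise from the word that superposes `p.1` and `q.1`, rewritten at its end by
`q` or at its beginning by `p`. -/
theorem IsCriticalPair.map_eq (hφ : ∀ r ∈ rules, φ r.1 = φ r.2) {fuel n : ℕ}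
    {p q : FreeMonoid α × FreeMonoid α} (hp : p ∈ rules) (hq : q ∈ rules) {u v : FreeMonoid α}
    (h : IsCriticalPair rules fuel p q n u v) : φ u = φ v := by
  obtain ⟨hpq, hu, hv⟩ := h
  have hu := congrArg (fun l => φ (ofList l)) hu
  have hv := congrArg (fun l => φ (ofList l)) hv
  have hp' := congrArg (fun l => φ (ofList l)) hpq
  have hq' := congrArg (fun l => φ (ofList l)) ((toList q.1).take_append_drop n)
  simp only [map_reduce hφ, List.reverse_nil, List.nil_append, ofList_append, map_mul,
    ofList_toList] at hu hv hp' hq'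
  rw [← hu, ← hv, ← hφ p hp, ← hφ q hq, hp', ← hq', mul_assoc]

theorem IsDerivation.map_eq (hφ : ∀ r ∈ rules, φ r.1 = φ r.2) {fuel : ℕ}
    {steps : List ((ℕ × ℕ × ℕ) × FreeMonoid α × FreeMonoid α)}
    (h : IsDerivation fuel rules steps) :
    ∀ r ∈ rules ++ steps.map Prod.snd, φ r.1 = φ r.2 := by
  induction steps generalizing rules with
  | nil => simpa using hφ
  | cons s steps ih =>
    obtain ⟨⟨p, hp, q, hq, hpq⟩, h⟩ := h
    have hr := hpq.map_eq hφ (List.mem_of_getElem? hp) (List.mem_of_getElem? hq)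
    have := ih (rules := rules ++ [s.2]) (by
      intro r h
      rcases List.mem_append.mp h with h | h
      · exact hφ r h
      · rwa [List.mem_singleton.mp h]) h
    simpa using this

end StringRewriting

/-! ### Completion of the defining relations of `H₄` -/

namespace CoxeterH4

open StringRewriting

/-- Relations that are derived successively from the defining ones, by critical pairs. -/
def derivation : List ((ℕ × ℕ × ℕ) × Word × Word) :=
  [((5, 7, 1), w321 * s3, s2 * w321),
   ((6, 9, 1), w432 * s4, s3 * w432),
   ((11, 8, 1), w4321 * s4, s3 * w4321),
   ((10, 5, 1), w3212 * s3 * s2, s2 * w3212 * s3),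
   ((12, 9, 1), w43212 * s4, s3 * w43212),
   ((14, 8, 1), w432121 * s4, s3 * w432121),
   ((14, 6, 1), w432123 * s4 * s3, s3 * w432123 * s4),
   ((15, 6, 1), w4321213 * s4 * s3, s3 * w4321213 * s4),
   ((13, 4, 1), w32121 ^ 2, s2 * w32121 * w3212),
   ((17, 5, 1), w43212132 * w432, s3 * w43212132 * s4 * s3),
   ((19, 4, 1), w432121321 * w432121, s3 * w432121321 * w43212),
   ((20, 18, 5), w4321213212 ^ 2, s3 * w4321213212 * w432121321),
   ((21, 21, 10), w43212132123 * w4321213212 * w432121321,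
     s3 * w43212132123 * w4321213212 * w43212132),
   ((22, 20, 9), w43212132123 ^ 2 * w432121321 * w43212,
     s3 * w43212132123 ^ 2 * w432121321 * w4321),
   ((23, 13, 4), w43212132123 ^ 2 * w4321213212 * w432123,
     s3 * w43212132123 ^ 2 * w4321213212 * w43212),
   ((24, 7, 1), w43212132123 ^ 2 * w4321213212 * w4321213,
     s3 * w43212132123 ^ 2 * w4321213212 * w432121),
   ((24, 16, 6), w43212132123 ^ 3 * w432123 * s4, s3 * w43212132123 ^ 3 * w432123),
   ((25, 17, 7), w43212132123 ^ 3 * w4321213 * s4, s3 * w43212132123 ^ 3 * w4321213),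
   ((27, 9, 1), w43212132123 ^ 3 * w43212132 * s4, s3 * w43212132123 ^ 3 * w43212132),
   ((28, 8, 1), w43212132123 ^ 3 * w432121321 * s4, s3 * w43212132123 ^ 3 * w432121321),
   ((29, 9, 1), w43212132123 ^ 3 * w4321213212 * s4, s3 * w43212132123 ^ 3 * w4321213212),
   ((30, 6, 1), w43212132123 ^ 4 * s4 * s3, s3 * w43212132123 ^ 4 * s4)]

/-- Positions count from `0`: the defining relations occupy `0` to `9`, the derived ones follow from
`10` on. The fuel `300` is merely large enough for these reductions. -/
theorem isDerivation_derivation : IsDerivation 300 relDefining derivation := by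
  decide +kernel

/-- A common reduct of the two sides proves the relation, whether or not the 32 rules are confluent.
-/
theorem reduce_eq_reduce :
    ∀ r ∈ relDefining ++ relH3 ++ relH4a ++ relH4b,
      reduce (relDefining ++ derivation.map Prod.snd) 300 [] (FreeMonoid.toList r.1) =
        reduce (relDefining ++ derivation.map Prod.snd) 300 [] (FreeMonoid.toList r.2) := by
  decide +kernel

end CoxeterH4

/-! ### The group of type `H₄` -/

namespace CoxeterH4

open StringRewriting GroebnerShirshov

/-- The element of `G` that is represented by a word. -/
noncomputable def wordProd : Word →* G :=
  FreeMonoid.lift fun i : Fin 4 => CoxeterMatrix.H₄.simple i.rev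

theorem toGroupAlgebra_eq : toGroupAlgebra = MonoidAlgebra.mapDomainAlgHom ℂ ℂ wordProd := by
  apply MonoidAlgebra.algHom_ext'
  · apply FreeMonoid.hom_eq
    intro i
    simp [toGroupAlgebra, wordProd]
  · ext

theorem wordProd_surjective : Function.Surjective wordProd := by
  intro g
  obtain ⟨l, rfl⟩ := CoxeterMatrix.H₄.toCoxeterSystem.wordProd_surjective g
  refine ⟨FreeMonoid.ofList (l.map Fin.rev), ?_⟩
  simp [wordProd, CoxeterSystem.wordProd, FreeMonoid.lift_ofList, Function.comp_def,
    CoxeterMatrix.toCoxeterSystem_simple]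

theorem wordProd_of_mul_of_pow (i j : Fin 4) :
    wordProd ((FreeMonoid.of i * FreeMonoid.of j) ^ CoxeterMatrix.H₄ i.rev j.rev) = 1 := by
  simpa [wordProd, CoxeterMatrix.toCoxeterSystem_simple] using
    CoxeterMatrix.H₄.toCoxeterSystem.simple_mul_simple_pow i.rev j.rev

theorem wordProd_of_mul_self (i : Fin 4) :
    wordProd (FreeMonoid.of i) * wordProd (FreeMonoid.of i) = 1 := by
  simpa [wordProd, CoxeterMatrix.toCoxeterSystem_simple] using
    CoxeterMatrix.H₄.toCoxeterSystem.simple_mul_simple_self i.rev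

/-- Cut `(st)^m = 1` into two halves of length `m`. Since generators are involutions, inverting the
second half reverses it, which gives the braid relation. -/
theorem wordProd_relDefining : ∀ r ∈ relDefining, wordProd r.1 = wordProd r.2 := by
  have inv : ∀ i, wordProd (FreeMonoid.of i) = (wordProd (FreeMonoid.of i))⁻¹ :=
    fun i => eq_inv_of_mul_eq_one_left (wordProd_of_mul_self i)
  have h₂ : ∀ i j : Fin 4, CoxeterMatrix.H₄ i.rev j.rev = 2 →
      wordProd (FreeMonoid.of i * FreeMonoid.of j) = wordProd (FreeMonoid.of j * FreeMonoid.of i) := by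
    intro i j hij
    have h := wordProd_of_mul_of_pow i j
    rw [hij, pow_two, map_mul] at h
    rw [eq_inv_of_mul_eq_one_left h, map_mul, mul_inv_rev, ← inv, ← inv, map_mul]
  have h₃ : ∀ i j : Fin 4, CoxeterMatrix.H₄ i.rev j.rev = 3 →
      wordProd (FreeMonoid.of i * FreeMonoid.of j * FreeMonoid.of i) =
        wordProd (FreeMonoid.of j * FreeMonoid.of i * FreeMonoid.of j) := by
    intro i j hij
    have h := wordProd_of_mul_of_pow i j
    have e : (FreeMonoid.of i * FreeMonoid.of j) ^ 3 = FreeMonoid.of i * FreeMonoid.of j *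
        FreeMonoid.of i * (FreeMonoid.of j * FreeMonoid.of i * FreeMonoid.of j) := rfl
    rw [hij, e, map_mul] at h
    rw [eq_inv_of_mul_eq_one_left h]
    simp only [map_mul, mul_inv_rev, ← inv, mul_assoc]
  have h₅ : wordProd (s2 * s1 * s2 * s1 * s2) = wordProd (s1 * s2 * s1 * s2 * s1) := by
    have h := wordProd_of_mul_of_pow 1 0
    have e : (FreeMonoid.of (1 : Fin 4) * FreeMonoid.of 0) ^ 5 =
        s2 * s1 * s2 * s1 * s2 * (s1 * s2 * s1 * s2 * s1) := rfl
    rw [show CoxeterMatrix.H₄ (Fin.rev 1) (Fin.rev 0) = 5 from rfl, e, map_mul] at h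
    rw [eq_inv_of_mul_eq_one_left h]
    simp only [map_mul, mul_inv_rev, s1, s2, ← inv, mul_assoc]
  have h₁ : ∀ i, wordProd (FreeMonoid.of i ^ 2) = wordProd 1 := fun i => by
    rw [pow_two, map_mul, wordProd_of_mul_self, map_one]
  simp only [relDefining, List.forall_mem_cons, List.not_mem_nil, false_imp_iff, implies_true,
    and_true]
  exact ⟨h₁ 0, h₁ 1, h₁ 2, h₁ 3, h₅, h₃ 2 1 rfl, h₃ 3 2 rfl, h₂ 2 0 rfl, h₂ 3 0 rfl, h₂ 3 1 rfl⟩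

/-- The set of pairs that represent the elements of `RHat`. -/
def relations : Set (Word × Word) :=
  {r | r ∈ relDefining ++ relH3 ++ relH4a ++ relH4b}

theorem wordProd_relations : ∀ r ∈ relations, wordProd r.1 = wordProd r.2 := by
  intro r hr
  have h := congrArg (fun l => wordProd (FreeMonoid.ofList l)) (reduce_eq_reduce r hr)
  simpa only [map_reduce (isDerivation_derivation.map_eq wordProd_relDefining),
    List.reverse_nil, List.nil_append, FreeMonoid.ofList_toList] using h

theorem degLex_relations : ∀ r ∈ relations, DegLex r.2 r.1 := by
  have h : ∀ r ∈ relDefining ++ relH3 ++ relH4a ++ relH4b,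
      (FreeMonoid.toList r.2).length < (FreeMonoid.toList r.1).length ∨
        (FreeMonoid.toList r.2).length = (FreeMonoid.toList r.1).length ∧
          FreeMonoid.toList r.2 < FreeMonoid.toList r.1 := by
    decide +kernel
  exact fun r hr => List.shortlex_def.mpr (h r hr)

/-! ### The reflection representation modulo `11` -/

/-- Coordinates with respect to the fundamental weights. -/
abbrev Weight : Type := ZMod 11 × ZMod 11 × ZMod 11 × ZMod 11

/-- The simple reflections in the coordinates of the fundamental weights, with `8` in place of
the golden ratio. -/
def reflect : Fin 4 → Weight → Weight
  | 0, (p, q, r, s) => (-p, q + 8 * p, r, s)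
  | 1, (p, q, r, s) => (p + 8 * q, -q, r + q, s)
  | 2, (p, q, r, s) => (p, q + r, -r, s + r)
  | 3, (p, q, r, s) => (p, q, r + s, -s)

/-- In `ZMod 11`, `8 ^ 2 = 8 + 1`, so `8` is a root of the polynomial of the golden ratio `2 cos (π
/ 5)` and the Coxeter relations survive reduction modulo `11`. The opposite monoid appears because
the first letter of a word acts first. -/
theorem isLiftable_reflect : CoxeterMatrix.H₄.IsLiftable
    fun i => MulOpposite.op (show Function.End Weight from reflect i.rev) := by
  intro i j
  refine MulOpposite.unop_injective (funext fun ⟨p, q, r, s⟩ => ?_)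
  change (reflect j.rev ∘ reflect i.rev)^[CoxeterMatrix.H₄ i j] (p, q, r, s) = (p, q, r, s)
  fin_cases i <;> fin_cases j <;> simp [CoxeterMatrix.H₄, reflect, Fin.rev] <;>
    ring_nf <;> reduce_mod_char <;> simp <;> ring_nf <;> reduce_mod_char

/-- The right action of `G` on weights. -/
noncomputable def action : G →* (Function.End Weight)ᵐᵒᵖ :=
  CoxeterMatrix.H₄.toCoxeterSystem.lift ⟨_, isLiftable_reflect⟩

/-- The right action of words on weights. -/
def act (v : Weight) (w : Word) : Weight :=
  (FreeMonoid.toList w).foldl (fun v i => reflect i v) v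

theorem act_mul (v : Weight) (w w' : Word) : act v (w * w') = act (act v w) w' := by
  simp [act]

theorem act_eq (v : Weight) (w : Word) : act v w = (action (wordProd w)).unop v := by
  induction w using FreeMonoid.inductionOn' generalizing v with
  | one => simp [act, Function.End.one_def]
  | of_mul i w ih =>
    have hi : action (wordProd (FreeMonoid.of i)) =
        MulOpposite.op (show Function.End Weight from reflect i) := by
      have := CoxeterMatrix.H₄.toCoxeterSystem.lift_apply_simple isLiftable_reflect i.rev
      simpa [action, wordProd, CoxeterMatrix.toCoxeterSystem_simple] using this
    rw [act_mul, ih, map_mul, map_mul, hi]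
    rfl

/-- Words with distinct images of a weight are separated in `G`, whatever words that fix the weight
stand before them. -/
theorem eq_of_wordProd_mul_eq {v : Weight} {L : List Word} (hL : (L.map (act v)).Nodup)
    {a a' w w' : Word} (ha : act v a = v) (ha' : act v a' = v) (hw : w ∈ L) (hw' : w' ∈ L)
    (h : wordProd (a * w) = wordProd (a' * w')) : w = w' ∧ wordProd a = wordProd a' := by
  have e : act v (a * w) = act v (a' * w') := by rw [act_eq, act_eq, h]
  rw [act_mul, act_mul, ha, ha'] at e
  obtain rfl := List.inj_on_of_nodup_map hL hw hw' e
  exact ⟨rfl, by simpa using h⟩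

/-- The last fundamental weight is fixed by `s1`, `s2`, `s3`, so its images depend only on the coset
modulo the parabolic subgroup of type `H₃`. The third weight plays this role for `s1`, `s2` below,
and `(1, 1, 0, 0)` separates the words in `s1`, `s2` themselves. -/
theorem nodup_map_act_words4 : (words4.map (act (0, 0, 0, 1))).Nodup := by
  decide +kernel

theorem nodup_map_act_words3 : (words3.map (act (0, 0, 1, 0))).Nodup := by
  decide +kernel

theorem nodup_map_act_words2 : (words2.map (act (1, 1, 0, 0))).Nodup := by
  decide +kernel

theorem act_words3 : ∀ w ∈ words3, act (0, 0, 0, 1) w = (0, 0, 0, 1) := by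
  decide +kernel

theorem act_words2 : ∀ w ∈ words2,
    act (0, 0, 0, 1) w = (0, 0, 0, 1) ∧ act (0, 0, 1, 0) w = (0, 0, 1, 0) := by
  decide +kernel

/-- The factors are recovered from the right: `a * b` fixes the last weight, so its image determines
`c`. After cancelling `c`, the third weight determines `b`, and then `a` remains. -/
theorem eq_of_wordProd_eq {a a' b b' c c' : Word} (ha : a ∈ words2) (ha' : a' ∈ words2)
    (hb : b ∈ words3) (hb' : b' ∈ words3) (hc : c ∈ words4) (hc' : c' ∈ words4)
    (h : wordProd (a * b * c) = wordProd (a' * b' * c')) : a = a' ∧ b = b' ∧ c = c' := by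
  have ⟨hcc, h⟩ := eq_of_wordProd_mul_eq nodup_map_act_words4
    (by rw [act_mul, (act_words2 a ha).1, act_words3 b hb])
    (by rw [act_mul, (act_words2 a' ha').1, act_words3 b' hb']) hc hc' h
  have ⟨hbb, h⟩ := eq_of_wordProd_mul_eq nodup_map_act_words3
    (act_words2 a ha).2 (act_words2 a' ha').2 hb hb' h
  have ⟨haa, _⟩ := eq_of_wordProd_mul_eq (a := 1) (a' := 1) nodup_map_act_words2
    rfl rfl ha ha' (by simpa using h)
  exact ⟨haa, hbb, hcc⟩

/-! ### Standard words -/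

/-- The products `M₂M₃M₄`. -/
def products : Set Word :=
  {u | ∃ M₂ ∈ words2, ∃ M₃ ∈ words3, ∃ M₄ ∈ words4, u = M₂ * M₃ * M₄}

theorem injOn_wordProd : Set.InjOn wordProd products := by
  rintro _ ⟨a, ha, b, hb, c, hc, rfl⟩ _ ⟨a', ha', b', hb', c', hc', rfl⟩ h
  obtain ⟨rfl, rfl, rfl⟩ := eq_of_wordProd_eq ha ha' hb hb' hc hc' h
  rfl

theorem ncard_products : products.ncard = 14400 := by
  classical
  have e : products = (fun u : Word × Word × Word => u.1 * u.2.1 * u.2.2) ''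
      (words2.toFinset ×ˢ words3.toFinset ×ˢ words4.toFinset : Finset (Word × Word × Word)) := by
    ext u
    simp only [products, Set.mem_ofPred_eq, Set.mem_image, Finset.mem_coe, Finset.mem_product,
      List.mem_toFinset, Prod.exists]
    grind
  -- Distinct images of a weight also show that the lists have no repetitions.
  rw [e, Set.InjOn.ncard_image, Set.ncard_coe_finset, Finset.card_product, Finset.card_product,
    List.toFinset_card_of_nodup nodup_map_act_words2.of_map,
    List.toFinset_card_of_nodup nodup_map_act_words3.of_map,
    List.toFinset_card_of_nodup nodup_map_act_words4.of_map]
  · rfl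
  · rintro ⟨a, b, c⟩ h ⟨a', b', c'⟩ h' hw
    simp only [Finset.mem_coe, Finset.mem_product, List.mem_toFinset] at h h'
    obtain ⟨rfl, rfl, rfl⟩ := eq_of_wordProd_eq h.1 h'.1 h.2.1 h'.2.1 h.2.2 h'.2.2
      (congrArg wordProd hw)
    rfl

/-- The left side of some relation is a suffix of the word. -/
def HasReducibleSuffix (w : Word) : Prop :=
  ∃ r ∈ relDefining ++ relH3 ++ relH4a ++ relH4b, FreeMonoid.toList r.1 <:+ FreeMonoid.toList w

instance (w : Word) : Decidable (HasReducibleSuffix w) :=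
  inferInstanceAs (Decidable (∃ r ∈ relDefining ++ relH3 ++ relH4a ++ relH4b, _))

instance : DecidableEq Word :=
  inferInstanceAs (DecidableEq (List (Fin 4)))

/-- The empty word is excluded because after an empty last factor the letters `s1`, `s2`, `s3`
extend an earlier factor; only `s4` starts a new last one. -/
theorem words4_mul_of : ∀ c ∈ words4, c ≠ 1 → ∀ i,
    HasReducibleSuffix (c * FreeMonoid.of i) ∨ c * FreeMonoid.of i ∈ words4 := by
  decide +kernel

theorem words3_mul_of : ∀ b ∈ words3, b ≠ 1 → ∀ i ≠ 3,
    HasReducibleSuffix (b * FreeMonoid.of i) ∨ b * FreeMonoid.of i ∈ words3 := by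
  decide +kernel

theorem words2_mul_of : ∀ a ∈ words2, ∀ i ≠ 3, i ≠ 2 →
    HasReducibleSuffix (a * FreeMonoid.of i) ∨ a * FreeMonoid.of i ∈ words2 := by
  decide +kernel

theorem mul_of_mem_products {u : Word} (hu : u ∈ products) (i : Fin 4)
    (h : ∀ v w, u * FreeMonoid.of i = v * w → ¬ HasReducibleSuffix w) :
    u * FreeMonoid.of i ∈ products := by
  obtain ⟨a, ha, b, hb, c, hc, rfl⟩ := hu
  by_cases hc1 : c = 1
  · subst hc1
    by_cases hi : i = 3
    · exact ⟨a, ha, b, hb, s4, by decide +kernel, by simp [hi, s4]⟩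
    by_cases hb1 : b = 1
    · subst hb1
      by_cases hi' : i = 2
      · exact ⟨a, ha, s3, by decide +kernel, 1, hc, by simp [hi', s3]⟩
      · refine ⟨_, (words2_mul_of a ha i hi hi').resolve_left (h 1 _ ?_), 1, hb, 1, hc, ?_⟩ <;> simp
    · refine ⟨a, ha, _, (words3_mul_of b hb hb1 i hi).resolve_left (h a _ ?_), 1, hc, ?_⟩ <;>
        simp [mul_assoc]
  · refine ⟨a, ha, b, hb, _, (words4_mul_of c hc hc1 i).resolve_left (h (a * b) _ ?_), ?_⟩ <;>
      simp [mul_assoc]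

/-- Prefixes of irreducible words are irreducible, so such a word is built letter by letter without
leaving the products. -/
theorem mem_products_of_forall_ne {u : Word}
    (hu : ∀ r ∈ relations, ∀ a b, u ≠ a * r.1 * b) : u ∈ products := by
  obtain ⟨l, rfl⟩ := FreeMonoid.ofList.surjective u
  induction l using List.reverseRecOn with
  | nil => exact ⟨1, by simp [words2], 1, by simp [words3], 1, by decide +kernel, rfl⟩
  | append_singleton l i ih =>
    rw [FreeMonoid.ofList_append, FreeMonoid.ofList_singleton] at hu ⊢
    refine mul_of_mem_products (ih fun r hr a b h => ?_) i fun v w hvw => ?_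
    · exact hu r hr a (b * FreeMonoid.of i) (by rw [h, mul_assoc])
    · rintro ⟨r, hr, t, ht⟩
      refine hu r hr (v * FreeMonoid.ofList t) 1 ?_
      rw [hvw, ← FreeMonoid.ofList_toList w, ← ht, FreeMonoid.ofList_append,
        FreeMonoid.ofList_toList, mul_one, mul_assoc]

theorem setOf_isStandard : {u : Word | IsStandard DegLex RHat u} = products := by
  have hsub : {u : Word | IsStandard DegLex RHat u} ⊆ products := fun u hu =>
    mem_products_of_forall_ne ((isStandard_binomials_iff (F := ℂ) isMonomialOrder_degLex
      degLex_relations).mp hu)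
  refine hsub.antisymm fun u hu => ?_
  -- The standard form `n` of the product `u` is itself a product with the same image in `G`, so `n
  -- = u` by injectivity and `u` is standard.
  obtain ⟨n, hn, hun, -⟩ :=
    exists_isStandard (F := ℂ) isMonomialOrder_degLex degLex_relations wordProd_relations u
  exact injOn_wordProd (hsub hn) hu hun ▸ hn

theorem injOn_wordProd_isStandard :
    Set.InjOn wordProd {u | IsStandard DegLex (binomials ℂ relations) u} :=
  setOf_isStandard.symm ▸ injOn_wordProd

theorem natCard_G : Nat.card G = 14400 := by
  rw [← ncard_products, ← setOf_isStandard, ← Set.ncard_univ]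
  exact ((bijOn_isStandard isMonomialOrder_degLex degLex_relations wordProd_relations
    injOn_wordProd_isStandard wordProd_surjective).ncard_eq).symm

end CoxeterH4

open CoxeterH4 GroebnerShirshov in
theorem mainTheorem1 :
    GroebnerShirshov.IsGSBasisFor GroebnerShirshov.DegLex CoxeterH4.RHat
      CoxeterH4.toGroupAlgebra ∧
    {u : CoxeterH4.Word |
        GroebnerShirshov.IsStandard GroebnerShirshov.DegLex CoxeterH4.RHat u} =
      {u | ∃ M₂ ∈ CoxeterH4.words2, ∃ M₃ ∈ CoxeterH4.words3, ∃ M₄ ∈ CoxeterH4.words4,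
        u = M₂ * M₃ * M₄} ∧
    (CoxeterH4.words2.length = 10 ∧ CoxeterH4.words3.length = 12 ∧
      CoxeterH4.words4.length = 120) ∧
    {u : CoxeterH4.Word |
        GroebnerShirshov.IsStandard GroebnerShirshov.DegLex CoxeterH4.RHat u}.ncard = 14400 ∧
    Nat.card CoxeterH4.G = 14400 ∧
    (LinearIndependent ℂ (fun u : {u : CoxeterH4.Word //
        GroebnerShirshov.IsStandard GroebnerShirshov.DegLex CoxeterH4.RHat u} =>
          CoxeterH4.toGroupAlgebra (MonoidAlgebra.of ℂ CoxeterH4.Word u.1)) ∧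
      Submodule.span ℂ (Set.range (fun u : {u : CoxeterH4.Word //
        GroebnerShirshov.IsStandard GroebnerShirshov.DegLex CoxeterH4.RHat u} =>
          CoxeterH4.toGroupAlgebra (MonoidAlgebra.of ℂ CoxeterH4.Word u.1))) = ⊤) := by
  rw [toGroupAlgebra_eq, setOf_isStandard]
  exact ⟨isGSBasisFor_binomials isMonomialOrder_degLex degLex_relations wordProd_relations
      injOn_wordProd_isStandard wordProd_surjective, rfl, ⟨rfl, rfl, rfl⟩, ncard_products, natCard_G,
    linearIndependent_isStandard injOn_wordProd_isStandard,
    span_isStandard isMonomialOrder_degLex degLex_relations wordProd_relations wordProd_surjective⟩
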